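/- Let $\mathcal{T}$ be the Toeplitz algebra, i.e. the universal unital $C^*$-algebra generated by an isometry $s$, and let $\sigma:\mathcal{T}\to C(S^1)$ be the symbol map, the unital $*$-homomorphism sending $s$ to the inclusion $S^1\hookrightarrow\mathbb{C}$. Let $\mathbb{Z}_2=\{1,-1\}$, $I=[-1,1]$, let $u\in C(\mathbb{Z}_2)$ be given by $u(\pm1)=\pm1$, and let $\iota_I\in C(I)$ be $\iota_I(t)=t$. Let $\rho:\mathcal{T}\to\mathcal{T}\otimes C(\mathbb{Z}_2)$ be the right coaction, the unital $*$-homomorphism with $\rho(s)=s\otimes u$. Define $$\delta_1:\mathbb{Z}_2\times I\to S^1,\quad \delta_1(k,t)=e^{i\pi(\frac14kt+\frac12k+\frac32)},\qquad \delta_2:I\times\mathbb{Z}_2\to S^1,\quad \delta_2(t,k)=e^{i\pi(-\frac14kt-\frac12k+1)},$$ and, with $\delta_1^*:C(S^1)\to C(\mathbb{Z}_2)\otimes C(I)$ and $\delta_2^*:C(S^1)\to C(I)\otimes C(\mathbb{Z}_2)$ the pullbacks (under the identifications $C(\mathbb{Z}_2\times I)=C(\mathbb{Z}_2)\otimes C(I)$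 and $C(I\times\mathbb{Z}_2)=C(I)\otimes C(\mathbb{Z}_2)$), put $\sigma_i=\delta_i^*\circ\sigma$ for $i=1,2$. Then there exist elements $\phi_1,\phi_2\in\mathcal{T}$ such that $$\rho(\phi_1)=\phi_1\otimes u,\qquad \rho(\phi_2)=\phi_2\otimes u,$$ $$\sigma_1(\phi_1)=u\otimes 1_{C(I)},\qquad \sigma_2(\phi_1)=\iota_I\otimes 1_{C(\mathbb{Z}_2)},$$ $$\sigma_2(\phi_2)=1_{C(I)}\otimes u,\qquad \sigma_1(\phi_2)=1_{C(\mathbb{Z}_2)}\otimes\iota_I,$$ $$(1-\phi_2^2)(1-\phi_1^2)\neq0.$$ -/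

import Mathlib

open scoped TensorProduct

noncomputable section

namespace Toeplitz

/-! ### The free unital complex star-algebra on one generator -/

/-- The free unital complex `*`-algebra on one generator `X`: the algebra of noncommutative
polynomials in two letters `true` (standing for `X`) and `false` (standing for `X*`). -/
def FreeStarAlg : Type := MonoidAlgebra ℂ (FreeMonoid Bool)

namespace FreeStarAlg

instance instRing : Ring FreeStarAlg := inferInstanceAs (Ring (MonoidAlgebra ℂ (FreeMonoid Bool)))

instance instAlgebra : Algebra ℂ FreeStarAlg :=
  inferInstanceAs (Algebra ℂ (MonoidAlgebra ℂ (FreeMonoid Bool)))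

/-- The element `c • w` of the free `*`-algebra. -/
def mono (w : FreeMonoid Bool) (c : ℂ) : FreeStarAlg := MonoidAlgebra.single w c

/-- The generator `X`. -/
def X : FreeStarAlg := mono (FreeMonoid.of true) 1

theorem mono_mul (v w : FreeMonoid Bool) (c d : ℂ) :
    mono v c * mono w d = mono (v * w) (c * d) :=
  MonoidAlgebra.single_mul_single v w c d

theorem one_eq : (1 : FreeStarAlg) = mono 1 1 := rfl

theorem smul_mono (w : FreeMonoid Bool) (c d : ℂ) : c • mono w d = mono w (c * d) :=
  MonoidAlgebra.smul_single c w d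

@[elab_as_elim]
theorem induction {P : FreeStarAlg → Prop} (a : FreeStarAlg)
    (hm : ∀ w c, P (mono w c)) (hadd : ∀ a b, P a → P b → P (a + b)) : P a := by
  have h0 : P 0 := by
    have := hm 1 0
    rwa [show mono 1 0 = 0 from MonoidAlgebra.single_zero _] at this
  refine MonoidAlgebra.induction_linear (motive := P) a h0 (fun f g => hadd f g) hm

/-- The involution on words: reverse the word and exchange `X` and `X*`. -/
def wordStar : FreeMonoid Bool →* (FreeMonoid Bool)ᵐᵒᵖ :=
  FreeMonoid.lift fun b => MulOpposite.op (FreeMonoid.of (!b))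

theorem wordStar_wordStar (w : FreeMonoid Bool) : (wordStar (wordStar w).unop).unop = w := by
  induction w using FreeMonoid.inductionOn' with
  | one => simp
  | of_mul b w ih => simp [wordStar] at ih ⊢; rw [ih]

/-- Words as elements of the opposite algebra, through the involution on words. -/
def wordStarOp : FreeMonoid Bool →* FreeStarAlgᵐᵒᵖ where
  toFun w := MulOpposite.op (mono (wordStar w).unop 1)
  map_one' := by rw [map_one]; rfl
  map_mul' v w := by
    rw [map_mul, MulOpposite.unop_mul, ← MulOpposite.op_mul, mono_mul, mul_one]

theorem commute_wordStarOp (c : ℂ) (w : FreeMonoid Bool) :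
    Commute (((algebraMap ℂ FreeStarAlgᵐᵒᵖ).comp (starRingEnd ℂ)) c) (wordStarOp w) :=
  Algebra.commute_algebraMap_left (A := FreeStarAlgᵐᵒᵖ) (starRingEnd ℂ c) (wordStarOp w)

/-- The involution of the free `*`-algebra as a ring homomorphism to the opposite algebra:
`c • w ↦ conj c • w*`. -/
def starHom : FreeStarAlg →+* FreeStarAlgᵐᵒᵖ :=
  MonoidAlgebra.liftNCRingHom ((algebraMap ℂ FreeStarAlgᵐᵒᵖ).comp (starRingEnd ℂ)) wordStarOp
    commute_wordStarOp

theorem starHom_mono (w : FreeMonoid Bool) (c : ℂ) :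
    (starHom (mono w c)).unop = mono (wordStar w).unop (starRingEnd ℂ c) := by
  have h : starHom (mono w c) = algebraMap ℂ FreeStarAlgᵐᵒᵖ (starRingEnd ℂ c) * wordStarOp w :=
    MonoidAlgebra.liftNCRingHom_single _ _ _ w c
  rw [h, ← Algebra.smul_def]
  change starRingEnd ℂ c • mono (wordStar w).unop 1 = _
  rw [smul_mono, mul_one]

instance instStarRing : StarRing FreeStarAlg where
  star a := (starHom a).unop
  star_involutive a := by
    induction a using induction with
    | hm w c => simp only [starHom_mono, wordStar_wordStar]; simp
    | hadd a b ha hb =>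
      simp only [map_add, MulOpposite.unop_add] at ha hb ⊢
      rw [ha, hb]
  star_mul a b := by simp
  star_add a b := by simp

theorem star_mono (w : FreeMonoid Bool) (c : ℂ) :
    star (mono w c) = mono (wordStar w).unop (starRingEnd ℂ c) := starHom_mono w c

instance instStarModule : StarModule ℂ FreeStarAlg where
  star_smul c a := by
    induction a using induction with
    | hm w d => simp [smul_mono, star_mono]
    | hadd a b ha hb => simp only [smul_add, star_add, ha, hb]

/-- The algebra homomorphism sending `X` to `b` and `X*` to `star b`. -/
def liftAlg {B : Type*} [Ring B] [StarRing B] [Algebra ℂ B] (b : B) : FreeStarAlg →ₐ[ℂ] B :=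
  MonoidAlgebra.lift ℂ B (FreeMonoid Bool) (FreeMonoid.lift fun x => if x then b else star b)

theorem liftAlg_mono {B : Type*} [Ring B] [StarRing B] [Algebra ℂ B] (b : B)
    (w : FreeMonoid Bool) (c : ℂ) :
    liftAlg b (mono w c) = c • FreeMonoid.lift (fun x => if x then b else star b) w :=
  MonoidAlgebra.lift_single _ _ _

/-- The unital `*`-homomorphism from the free `*`-algebra sending `X` to `b`. -/
def lift {B : Type*} [Ring B] [StarRing B] [Algebra ℂ B] [StarModule ℂ B] (b : B) :
    FreeStarAlg →⋆ₐ[ℂ] B where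
  toAlgHom := liftAlg b
  map_star' a := by
    change liftAlg b (star a) = star (liftAlg b a)
    induction a using induction with
    | hm w c =>
      rw [star_mono, liftAlg_mono, liftAlg_mono, star_smul]
      congr 1
      induction w using FreeMonoid.inductionOn' with
      | one => simp
      | of_mul x w ih =>
        rw [map_mul, map_mul, MulOpposite.unop_mul, map_mul, ih, star_mul]
        cases x <;> simp [wordStar]
    | hadd a b ha hb => rw [star_add, map_add, map_add, ha, hb, star_add]

theorem lift_X {B : Type*} [Ring B] [StarRing B] [Algebra ℂ B] [StarModule ℂ B] (b : B) :
    lift b X = b := by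
  change liftAlg b (mono _ _) = b
  rw [liftAlg_mono]; simp

theorem hom_ext {B : Type*} [Ring B] [StarRing B] [Algebra ℂ B]
    {f g : FreeStarAlg →⋆ₐ[ℂ] B} (h : f X = g X) : f = g := by
  have hs : f (star X) = g (star X) := by rw [map_star, map_star, h]
  have hX : star X = mono (FreeMonoid.of false) 1 := by simp [X, star_mono, wordStar]
  ext a
  induction a using induction with
  | hm w c =>
    have : mono w c = c • mono w 1 := by rw [smul_mono, mul_one]
    rw [this, map_smul, map_smul]
    congr 1
    induction w using FreeMonoid.inductionOn' with
    | one => rw [← one_eq, map_one, map_one]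
    | of_mul x w ih =>
      have : mono (FreeMonoid.of x * w) 1 = mono (FreeMonoid.of x) 1 * mono w 1 := by
        rw [mono_mul, mul_one]
      rw [this, map_mul, map_mul, ih (by rw [smul_mono, mul_one])]
      congr 1
      cases x
      · rw [← hX, hs]
      · exact h
  | hadd a b ha hb => rw [map_add, map_add, ha, hb]

/-! ### The universal norm -/

/-- The `C*`-seminorms on the free `*`-algebra for which the generator is an isometry, that is,
which vanish on `X* X - 1`. -/
structure IsCStarSeminorm (p : Seminorm ℂ FreeStarAlg) : Prop where
  mul_le : ∀ a b, p (a * b) ≤ p a * p b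
  star_mul_self : ∀ a, p (star a * a) = p a ^ 2
  isometry : p (star X * X - 1) = 0

namespace IsCStarSeminorm

theorem one_le {p : Seminorm ℂ FreeStarAlg} (hp : IsCStarSeminorm p) : p 1 ≤ 1 := by
  have h := hp.star_mul_self 1
  rw [star_one, one_mul] at h
  nlinarith [apply_nonneg p 1]

theorem X_le {p : Seminorm ℂ FreeStarAlg} (hp : IsCStarSeminorm p) : p X ≤ 1 := by
  have h := hp.star_mul_self X
  have h1 : p (star X * X) ≤ 1 := by
    calc p (star X * X) = p ((star X * X - 1) + 1) := by rw [sub_add_cancel]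
      _ ≤ p (star X * X - 1) + p 1 := map_add_le_add p _ _
      _ ≤ 1 := by rw [hp.isometry, zero_add]; exact hp.one_le
  nlinarith [apply_nonneg p X]

theorem star_le {p : Seminorm ℂ FreeStarAlg} (hp : IsCStarSeminorm p) (a : FreeStarAlg) :
    p (star a) ≤ p a := by
  have h := hp.star_mul_self (star a)
  rw [star_star] at h
  have h2 := hp.mul_le a (star a)
  by_contra hlt
  push Not at hlt
  nlinarith [apply_nonneg p a, apply_nonneg p (star a)]

theorem mono_le {p : Seminorm ℂ FreeStarAlg} (hp : IsCStarSeminorm p) (w : FreeMonoid Bool) :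
    p (mono w 1) ≤ 1 := by
  have hX : star X = mono (FreeMonoid.of false) 1 := by simp [X, star_mono, wordStar]
  induction w using FreeMonoid.inductionOn' with
  | one => rw [← one_eq]; exact hp.one_le
  | of_mul x w ih =>
    have h1 : mono (FreeMonoid.of x * w) 1 = mono (FreeMonoid.of x) 1 * mono w 1 := by
      rw [mono_mul, mul_one]
    have h2 : p (mono (FreeMonoid.of x) 1) ≤ 1 := by
      cases x
      · rw [← hX]; exact (hp.star_le X).trans hp.X_le
      · exact hp.X_le
    rw [h1]
    exact (hp.mul_le _ _).trans (mul_le_one₀ h2 (apply_nonneg p _) ih)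

end IsCStarSeminorm

theorem bddAbove_seminorms (a : FreeStarAlg) :
    BddAbove (Set.range fun p : {p : Seminorm ℂ FreeStarAlg // IsCStarSeminorm p} => p.1 a) := by
  suffices h : ∃ C, ∀ p : Seminorm ℂ FreeStarAlg, IsCStarSeminorm p → p a ≤ C by
    obtain ⟨C, hC⟩ := h
    exact ⟨C, by rintro _ ⟨p, rfl⟩; exact hC p.1 p.2⟩
  induction a using induction with
  | hm w c =>
    refine ⟨‖c‖, fun p hp => ?_⟩
    rw [show mono w c = c • mono w 1 by rw [smul_mono, mul_one], map_smul_eq_mul]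
    exact mul_le_of_le_one_right (norm_nonneg c) (hp.mono_le w)
  | hadd a b ha hb =>
    obtain ⟨C, hC⟩ := ha
    obtain ⟨D, hD⟩ := hb
    exact ⟨C + D, fun p hp => (map_add_le_add p a b).trans (add_le_add (hC p hp) (hD p hp))⟩

instance nonempty_seminorms : Nonempty {p : Seminorm ℂ FreeStarAlg // IsCStarSeminorm p} :=
  ⟨⟨0, ⟨fun _ _ => by simp, fun _ => by simp, by simp⟩⟩⟩

theorem le_iSup_seminorms {p : Seminorm ℂ FreeStarAlg} (hp : IsCStarSeminorm p)
    (a : FreeStarAlg) :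
    p a ≤ ⨆ q : {q : Seminorm ℂ FreeStarAlg // IsCStarSeminorm q}, q.1 a :=
  le_ciSup (bddAbove_seminorms a) (⟨p, hp⟩ : {q // IsCStarSeminorm q})

/-- The largest `C*`-seminorm on the free `*`-algebra for which the generator is an isometry. -/
def universalSeminorm : Seminorm ℂ FreeStarAlg :=
  Seminorm.of (fun a => ⨆ p : {p : Seminorm ℂ FreeStarAlg // IsCStarSeminorm p}, p.1 a)
    (fun a b => ciSup_le fun p => (map_add_le_add p.1 a b).trans
      (add_le_add (le_iSup_seminorms p.2 a) (le_iSup_seminorms p.2 b)))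
    (fun c a => by
      simp only [map_smul_eq_mul]
      exact (Real.mul_iSup_of_nonneg (norm_nonneg c) _).symm)

theorem le_universalSeminorm {p : Seminorm ℂ FreeStarAlg} (hp : IsCStarSeminorm p)
    (a : FreeStarAlg) : p a ≤ universalSeminorm a := le_iSup_seminorms hp a

theorem universalSeminorm_le {a : FreeStarAlg} {C : ℝ}
    (h : ∀ p : Seminorm ℂ FreeStarAlg, IsCStarSeminorm p → p a ≤ C) : universalSeminorm a ≤ C :=
  ciSup_le fun p => h p.1 p.2

theorem isCStarSeminorm_universalSeminorm : IsCStarSeminorm universalSeminorm where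
  mul_le a b := universalSeminorm_le fun p hp => (hp.mul_le a b).trans
    (mul_le_mul (le_universalSeminorm hp a) (le_universalSeminorm hp b) (apply_nonneg p b)
      (apply_nonneg _ a))
  star_mul_self a := by
    refine le_antisymm (universalSeminorm_le fun p hp => ?_) ?_
    · rw [hp.star_mul_self]
      exact pow_le_pow_left₀ (apply_nonneg p a) (le_universalSeminorm hp a) 2
    · refine (Real.le_sqrt (apply_nonneg _ _) (apply_nonneg _ _)).1 ?_
      refine universalSeminorm_le fun p hp => Real.le_sqrt_of_sq_le ?_
      rw [← hp.star_mul_self]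
      exact le_universalSeminorm hp _
  isometry := le_antisymm (universalSeminorm_le fun p hp => hp.isometry.le) (apply_nonneg _ _)

instance instSeminormedRing : SeminormedRing FreeStarAlg where
  __ := instRing
  __ := universalSeminorm.toAddGroupSeminorm.toSeminormedAddCommGroup
  norm_mul_le := isCStarSeminorm_universalSeminorm.mul_le

theorem norm_def (a : FreeStarAlg) : ‖a‖ = universalSeminorm a := rfl

instance instNormedAlgebra : NormedAlgebra ℂ FreeStarAlg where
  __ := instAlgebra
  norm_smul_le c a := (map_smul_eq_mul universalSeminorm c a).le

instance instNormedStarGroup : NormedStarGroup FreeStarAlg where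
  norm_star_le := isCStarSeminorm_universalSeminorm.star_le

end FreeStarAlg

/-! ### The Toeplitz algebra -/

open UniformSpace

/-- The Toeplitz algebra: the universal unital `C*`-algebra generated by an isometry, that is,
the (Hausdorff) completion of the free `*`-algebra in the largest `C*`-seminorm for which the
generator is an isometry. -/
def ToeplitzAlgebra : Type := Completion FreeStarAlg

namespace ToeplitzAlgebra

instance instNormedRing : NormedRing ToeplitzAlgebra :=
  inferInstanceAs (NormedRing (Completion FreeStarAlg))

instance instAlgebra : Algebra ℂ ToeplitzAlgebra :=
  inferInstanceAs (Algebra ℂ (Completion FreeStarAlg))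

instance instNormedAlgebra : NormedAlgebra ℂ ToeplitzAlgebra where
  __ := instAlgebra
  norm_smul_le := norm_smul_le (α := ℂ) (β := Completion FreeStarAlg)

instance instCompleteSpace : CompleteSpace ToeplitzAlgebra :=
  inferInstanceAs (CompleteSpace (Completion FreeStarAlg))

/-- The canonical map of the free `*`-algebra to the Toeplitz algebra. -/
def of : FreeStarAlg →+* ToeplitzAlgebra := Completion.coeRingHom

theorem norm_of (a : FreeStarAlg) : ‖of a‖ = ‖a‖ := Completion.norm_coe a

theorem of_smul (c : ℂ) (a : FreeStarAlg) : of (c • a) = c • of a := Completion.coe_smul c a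

theorem denseRange_of : DenseRange of := Completion.denseRange_coe

theorem continuous_of : Continuous of := Completion.continuous_coe _

instance instStar : Star ToeplitzAlgebra where
  star := Completion.map (star : FreeStarAlg → FreeStarAlg)

theorem continuous_star : Continuous (star : ToeplitzAlgebra → ToeplitzAlgebra) :=
  Completion.continuous_map

theorem star_of (a : FreeStarAlg) : star (of a) = of (star a) :=
  Completion.map_coe (starNormedAddGroupHom (E := FreeStarAlg)).uniformContinuous a

instance instCStarAlgebra : CStarAlgebra ToeplitzAlgebra where
  star_involutive a := by
    refine denseRange_of.induction_on a (isClosed_eq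
      (continuous_star.comp continuous_star) continuous_id) fun a => ?_
    rw [star_of, star_of, star_star]
  star_mul a b := by
    refine denseRange_of.induction_on₂ (isClosed_eq ?_ ?_) (fun a b => ?_) a b
    · exact continuous_star.comp continuous_mul
    · exact (continuous_star.comp continuous_snd).mul (continuous_star.comp continuous_fst)
    · rw [← map_mul, star_of, star_of, star_of, star_mul, map_mul]
  star_add a b := by
    refine denseRange_of.induction_on₂ (isClosed_eq ?_ ?_) (fun a b => ?_) a b
    · exact continuous_star.comp continuous_add
    · exact (continuous_star.comp continuous_fst).add (continuous_star.comp continuous_snd)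
    · rw [← map_add, star_of, star_of, star_of, star_add, map_add]
  norm_mul_self_le a := by
    refine denseRange_of.induction_on a (isClosed_le ?_ ?_) fun a => ?_
    · exact continuous_norm.mul continuous_norm
    · exact continuous_norm.comp (continuous_star.mul continuous_id)
    · rw [star_of, ← map_mul, norm_of, norm_of, FreeStarAlg.norm_def, FreeStarAlg.norm_def,
        FreeStarAlg.isCStarSeminorm_universalSeminorm.star_mul_self, sq]
  star_smul c a := by
    refine denseRange_of.induction_on a (isClosed_eq ?_ ?_) fun a => ?_
    · exact continuous_star.comp (continuous_const_smul c)
    · exact continuous_star.const_smul (star c)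
    · rw [← of_smul, star_of, star_of, star_smul, of_smul]

/-- The generating isometry. -/
def s : ToeplitzAlgebra := of FreeStarAlg.X

theorem star_s_mul_s : star s * s = 1 := by
  rw [← sub_eq_zero, ← norm_eq_zero, s, star_of, ← map_mul, ← map_one of, ← map_sub, norm_of]
  exact FreeStarAlg.isCStarSeminorm_universalSeminorm.isometry

section Lift

variable {B : Type*} [CStarAlgebra B]

theorem norm_lift_le (b : B) (hb : star b * b = 1) (a : FreeStarAlg) :
    ‖FreeStarAlg.lift b a‖ ≤ ‖a‖ := by
  let p : Seminorm ℂ FreeStarAlg :=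
    (normSeminorm ℂ B).comp (FreeStarAlg.lift b).toAlgHom.toLinearMap
  have hpa : ∀ x, p x = ‖FreeStarAlg.lift b x‖ := fun _ => rfl
  have hp : FreeStarAlg.IsCStarSeminorm p :=
    { mul_le := fun x y => by simp only [hpa, map_mul]; exact norm_mul_le _ _
      star_mul_self := fun x => by
        simp only [hpa, map_mul, map_star]; rw [CStarRing.norm_star_mul_self, sq]
      isometry := by
        rw [hpa, map_sub, map_mul, map_star, FreeStarAlg.lift_X, hb, map_one, sub_self,
          norm_zero] }
  exact FreeStarAlg.le_universalSeminorm hp a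

theorem continuous_freeLift (b : B) (hb : star b * b = 1) : Continuous (FreeStarAlg.lift b) :=
  AddMonoidHomClass.continuous_of_bound (FreeStarAlg.lift b) 1 fun a => by
    rw [one_mul]; exact norm_lift_le b hb a

/-- The universal property as a ring homomorphism: extension by continuity. -/
def liftRingHom (b : B) (hb : star b * b = 1) : ToeplitzAlgebra →+* B :=
  Completion.extensionHom (FreeStarAlg.lift b : FreeStarAlg →+* B) (continuous_freeLift b hb)

theorem liftRingHom_of (b : B) (hb : star b * b = 1) (a : FreeStarAlg) :
    liftRingHom b hb (of a) = FreeStarAlg.lift b a :=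
  Completion.extensionHom_coe _ (continuous_freeLift b hb) a

theorem continuous_liftRingHom (b : B) (hb : star b * b = 1) : Continuous (liftRingHom b hb) :=
  Completion.continuous_extension

/-- The universal property: for an isometry `b` in a unital `C*`-algebra, the unital
`*`-homomorphism of the Toeplitz algebra sending `s` to `b`. -/
def lift (b : B) (hb : star b * b = 1) : ToeplitzAlgebra →⋆ₐ[ℂ] B where
  __ := liftRingHom b hb
  commutes' c := by
    change liftRingHom b hb (algebraMap ℂ ToeplitzAlgebra c) = _
    rw [Algebra.algebraMap_eq_smul_one, Algebra.algebraMap_eq_smul_one, ← map_one of, ← of_smul,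
      liftRingHom_of, map_smul, map_one]
  map_star' a := by
    change liftRingHom b hb (star a) = star (liftRingHom b hb a)
    have hc := continuous_liftRingHom b hb
    refine denseRange_of.induction_on a (isClosed_eq (hc.comp continuous_star) hc.star)
      fun a => ?_
    rw [star_of, liftRingHom_of, liftRingHom_of, map_star]

theorem lift_s (b : B) (hb : star b * b = 1) : lift b hb s = b :=
  (liftRingHom_of b hb FreeStarAlg.X).trans (FreeStarAlg.lift_X b)

/-- A unital `*`-homomorphism from the Toeplitz algebra is determined by the image of `s`. -/
theorem hom_ext {f g : ToeplitzAlgebra →⋆ₐ[ℂ] B} (h : f s = g s) : f = g := by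
  have hf : Continuous f := AddMonoidHomClass.continuous_of_bound f 1 fun a => by
    rw [one_mul]; exact NonUnitalStarAlgHom.norm_apply_le f a
  have hg : Continuous g := AddMonoidHomClass.continuous_of_bound g 1 fun a => by
    rw [one_mul]; exact NonUnitalStarAlgHom.norm_apply_le g a
  let ofHom : FreeStarAlg →⋆ₐ[ℂ] ToeplitzAlgebra :=
    { of with
      commutes' := fun c => by
        change of (algebraMap ℂ FreeStarAlg c) = _
        rw [Algebra.algebraMap_eq_smul_one, Algebra.algebraMap_eq_smul_one, of_smul, map_one]
      map_star' := fun a => (star_of a).symm }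
  have key : f.comp ofHom = g.comp ofHom := FreeStarAlg.hom_ext h
  ext a
  exact denseRange_of.induction_on a (isClosed_eq hf hg) fun a => DFunLike.congr_fun key a

end Lift

end ToeplitzAlgebra

/-! ### Functions on `ℤ₂ = {1, -1}` and tensor products with them -/

/-- The interval `I = [-1, 1]`. -/
abbrev I : Type := Set.Icc (-1 : ℝ) 1

/-- The generator `u` of `C(ℤ₂)`, where `ℤ₂ = {1, -1}`: `u(±1) = ±1`. -/
def u : C(ℤˣ, ℂ) := ⟨fun k => ((k : ℤ) : ℂ), continuous_of_discreteTopology⟩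

/-- The inclusion `ι_I(t) = t` as an element of `C(I)`. -/
def iotaI : C(I, ℂ) := ⟨fun t => ((t : ℝ) : ℂ), by fun_prop⟩

/-- The indicator function of the point `k` of `ℤ₂`. -/
def indicator (k : ℤˣ) : C(ℤˣ, ℂ) := ⟨Pi.single k 1, continuous_of_discreteTopology⟩

section Tensor

variable {A : Type*} [CStarAlgebra A]

/-- The canonical homomorphism `A ⊗ C(ℤ₂) → C(ℤ₂, A)`, `a ⊗ f ↦ (k ↦ f(k) a)`. -/
def tensorToFun : A ⊗[ℂ] C(ℤˣ, ℂ) →ₐ[ℂ] C(ℤˣ, A) :=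
  Algebra.TensorProduct.lift
    { toFun := fun a => ContinuousMap.const ℤˣ a
      map_one' := rfl
      map_mul' := fun _ _ => rfl
      map_zero' := rfl
      map_add' := fun _ _ => rfl
      commutes' := fun _ => rfl }
    { toFun := fun f => ⟨fun k => algebraMap ℂ A (f k), continuous_of_discreteTopology⟩
      map_one' := by ext; simp
      map_mul' := fun _ _ => by ext; simp
      map_zero' := by ext; simp
      map_add' := fun _ _ => by ext; simp
      commutes' := fun _ => by ext; rfl }
    (fun a f => by ext k; exact (Algebra.commutes (f k) a).symm)

theorem tensorToFun_tmul (a : A) (f : C(ℤˣ, ℂ)) (k : ℤˣ) :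
    tensorToFun (a ⊗ₜ[ℂ] f) k = f k • a := by
  rw [Algebra.smul_def, Algebra.commutes]
  exact congrArg (fun F : C(ℤˣ, A) => F k) (Algebra.TensorProduct.lift_tmul _ _ _ a f)

/-- Since `ℤ₂` is finite, the algebraic tensor product `A ⊗ C(ℤ₂)` is `C(ℤ₂, A)`. -/
def tensorEquiv : A ⊗[ℂ] C(ℤˣ, ℂ) ≃⋆ₐ[ℂ] C(ℤˣ, A) where
  toFun := tensorToFun
  invFun F := ∑ k : ℤˣ, F k ⊗ₜ[ℂ] indicator k
  left_inv x := by
    induction x using TensorProduct.induction_on with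
    | zero => simp
    | tmul a f =>
      simp only [tensorToFun_tmul, TensorProduct.smul_tmul]
      rw [← TensorProduct.tmul_sum]
      congr 1
      ext k
      rw [ContinuousMap.sum_apply, Finset.sum_eq_single k]
      · simp [indicator]
      · intro l _ hl
        simp [indicator, Pi.single_eq_of_ne hl.symm]
      · exact fun h => absurd (Finset.mem_univ k) h
    | add x y hx hy =>
      simp only [map_add, ContinuousMap.add_apply, TensorProduct.add_tmul,
        Finset.sum_add_distrib, hx, hy]
  right_inv F := by
    ext k
    rw [map_sum, ContinuousMap.sum_apply, Finset.sum_eq_single k]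
    · simp [tensorToFun_tmul, indicator]
    · intro l _ hl
      simp [tensorToFun_tmul, indicator, Pi.single_eq_of_ne hl.symm]
    · exact fun h => absurd (Finset.mem_univ k) h
  map_mul' := map_mul _
  map_add' := map_add _
  map_smul' := map_smul _
  map_star' x := by
    induction x using TensorProduct.induction_on with
    | zero => simp
    | tmul a f => ext k; simp [tensorToFun_tmul]
    | add x y hx hy => simp only [star_add, map_add, hx, hy]

end Tensor

/-! ### The coaction, the symbol map and its restrictions -/

/-- The element `s ⊗ u` of `T ⊗ C(ℤ₂) = C(ℤ₂, T)` is an isometry. -/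
theorem isometry_s_tmul_u :
    star (tensorEquiv (ToeplitzAlgebra.s ⊗ₜ[ℂ] u)) * tensorEquiv (ToeplitzAlgebra.s ⊗ₜ[ℂ] u) =
      1 := by
  have hu : star u * u = 1 := by
    ext k
    rcases Int.units_eq_one_or k with rfl | rfl <;> simp [u]
  rw [← map_star, ← map_mul, TensorProduct.star_tmul, Algebra.TensorProduct.tmul_mul_tmul,
    ToeplitzAlgebra.star_s_mul_s, hu, ← Algebra.TensorProduct.one_def, map_one]

/-- The right coaction `ρ : T → T ⊗ C(ℤ₂)`, the unital `*`-homomorphism with `s ↦ s ⊗ u`. -/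
def coaction : ToeplitzAlgebra →⋆ₐ[ℂ] ToeplitzAlgebra ⊗[ℂ] C(ℤˣ, ℂ) :=
  (tensorEquiv (A := ToeplitzAlgebra)).symm.toStarAlgHom.comp
    (ToeplitzAlgebra.lift (tensorEquiv (ToeplitzAlgebra.s ⊗ₜ[ℂ] u)) isometry_s_tmul_u)

theorem coaction_s : coaction ToeplitzAlgebra.s = ToeplitzAlgebra.s ⊗ₜ[ℂ] u := by
  change tensorEquiv.symm (ToeplitzAlgebra.lift _ isometry_s_tmul_u ToeplitzAlgebra.s) = _
  rw [ToeplitzAlgebra.lift_s, StarAlgEquiv.symm_apply_apply]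

/-- The unitary generator of `C(S¹)`, the inclusion `S¹ → ℂ`. -/
def uTilde : C(Circle, ℂ) := ⟨fun z => (z : ℂ), by fun_prop⟩

theorem star_uTilde_mul_uTilde : star uTilde * uTilde = 1 := by
  ext z
  change starRingEnd ℂ (z : ℂ) * (z : ℂ) = 1
  rw [← Complex.normSq_eq_conj_mul_self, Circle.normSq_coe, Complex.ofReal_one]

/-- The symbol map `σ : T → C(S¹)`, the unital `*`-homomorphism sending `s` to the unitary
generator of `C(S¹)`. -/
def symbol : ToeplitzAlgebra →⋆ₐ[ℂ] C(Circle, ℂ) :=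
  ToeplitzAlgebra.lift uTilde star_uTilde_mul_uTilde

/-- `δ₁ : ℤ₂ × I → S¹`, `(k, t) ↦ exp(iπ(kt/4 + k/2 + 3/2))`. -/
def delta1 : C(ℤˣ × I, Circle) where
  toFun x := Circle.exp (Real.pi *
    (1 / 4 * ((x.1 : ℤ) : ℝ) * (x.2 : ℝ) + 1 / 2 * ((x.1 : ℤ) : ℝ) + 3 / 2))
  continuous_toFun := by
    have h : Continuous fun k : ℤˣ => ((k : ℤ) : ℝ) := continuous_of_discreteTopology
    fun_prop

/-- `δ₂ : I × ℤ₂ → S¹`, `(t, k) ↦ exp(iπ(-kt/4 - k/2 + 1))`. -/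
def delta2 : C(I × ℤˣ, Circle) where
  toFun x := Circle.exp (Real.pi *
    (-(1 / 4 * ((x.2 : ℤ) : ℝ) * (x.1 : ℝ)) - 1 / 2 * ((x.2 : ℤ) : ℝ) + 1))
  continuous_toFun := by
    have h : Continuous fun k : ℤˣ => ((k : ℤ) : ℝ) := continuous_of_discreteTopology
    fun_prop

/-- The identification `C(ℤ₂ × I) = C(ℤ₂, C(I))`. -/
def curryHom : C(ℤˣ × I, ℂ) →ₐ[ℂ] C(ℤˣ, C(I, ℂ)) where
  toFun F := F.curry
  map_one' := rfl
  map_mul' _ _ := rfl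
  map_zero' := rfl
  map_add' _ _ := rfl
  commutes' _ := rfl

/-- The pullback `δ₁* : C(S¹) → C(ℤ₂) ⊗ C(I)`, with `C(ℤ₂) ⊗ C(I)` identified with `C(ℤ₂ × I)`. -/
def delta1Pullback : C(Circle, ℂ) →ₐ[ℂ] C(ℤˣ, ℂ) ⊗[ℂ] C(I, ℂ) :=
  (Algebra.TensorProduct.comm ℂ C(I, ℂ) C(ℤˣ, ℂ)).toAlgHom.comp <|
    ((tensorEquiv (A := C(I, ℂ))).symm.toStarAlgHom.toAlgHom.comp curryHom).comp
      (ContinuousMap.compRightAlgHom ℂ ℂ delta1)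

/-- The pullback `δ₂* : C(S¹) → C(I) ⊗ C(ℤ₂)`, with `C(I) ⊗ C(ℤ₂)` identified with `C(I × ℤ₂)`. -/
def delta2Pullback : C(Circle, ℂ) →ₐ[ℂ] C(I, ℂ) ⊗[ℂ] C(ℤˣ, ℂ) :=
  ((tensorEquiv (A := C(I, ℂ))).symm.toStarAlgHom.toAlgHom.comp curryHom).comp
    (ContinuousMap.compRightAlgHom ℂ ℂ (delta2.comp ContinuousMap.prodSwap))

theorem tensorEquiv_comm_delta1Pullback (f : C(Circle, ℂ)) (k : ℤˣ) (t : I) :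
    tensorEquiv (Algebra.TensorProduct.comm ℂ C(ℤˣ, ℂ) C(I, ℂ) (delta1Pullback f)) k t =
      f (delta1 (k, t)) := by
  have h : Algebra.TensorProduct.comm ℂ C(ℤˣ, ℂ) C(I, ℂ) (delta1Pullback f) =
      (tensorEquiv (A := C(I, ℂ))).symm (curryHom (f.comp delta1)) :=
    (Algebra.TensorProduct.comm ℂ C(I, ℂ) C(ℤˣ, ℂ)).symm_apply_apply _
  rw [h, StarAlgEquiv.apply_symm_apply]
  rfl

theorem tensorEquiv_delta2Pullback (f : C(Circle, ℂ)) (t : I) (k : ℤˣ) :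
    tensorEquiv (delta2Pullback f) k t = f (delta2 (t, k)) := by
  have h : delta2Pullback f = (tensorEquiv (A := C(I, ℂ))).symm
      (curryHom (f.comp (delta2.comp ContinuousMap.prodSwap))) := rfl
  rw [h, StarAlgEquiv.apply_symm_apply]
  rfl

/-- `σ₁ = δ₁* ∘ σ`. -/
def sigma1 : ToeplitzAlgebra →ₐ[ℂ] C(ℤˣ, ℂ) ⊗[ℂ] C(I, ℂ) :=
  delta1Pullback.comp symbol.toAlgHom

/-- `σ₂ = δ₂* ∘ σ`. -/
def sigma2 : ToeplitzAlgebra →ₐ[ℂ] C(I, ℂ) ⊗[ℂ] C(ℤˣ, ℂ) :=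
  delta2Pullback.comp symbol.toAlgHom

end Toeplitz

end

open Toeplitz

/-! The images of `delta1` are the arcs of the circle around 1 and -1, and those of `delta2` the
arcs around i and -i. On the first pair the real part is ±cos(πt/4) and the imaginary part
sin(πt/4); on the second pair the roles are exchanged. One truncated arcsine turns the sine into t
and the cosine into 1, so applied to Re z and Im z it gives exactly the symbols required of φ₁ and
φ₂.

These symbols lift by continuous functional calculus in the self-adjoint elements (s + s*)/2 and (s
- s*)/(2i). Both elements are odd for the automorphism s ↦ -s, and so is the function, hence the
lifts are odd; oddness is the coaction condition (`coaction_eq_tmul_u`, `exists_odd_lift`).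

The inequality is invisible to the symbol, since at each point of the circle one of the two symbols
is ±1. Instead, the lifts a, b are perturbed to a + ck, b + dk, where k = `swap` is odd with zero
symbol, so no other condition changes. If the product vanished for all c and d, second differences
in both parameters would give 4k⁴ = 0 (`exists_one_sub_sq_mul_ne_zero`). But the projection p = 1 -
ss* satisfies pk² = p (`defect_mul_swap_sq`), and p ≠ 0 because the unilateral shift is not unitary
(`defect_ne_zero`). -/

noncomputable section

namespace Toeplitz

/-! ### The truncated arcsine -/

/-- The odd function `x ↦ (4 / π) arcsin x`, truncated to `[-1, 1]`. -/
def truncArcsin (x : ℝ) : ℝ := max (-1) (min 1 (4 / Real.pi * Real.arcsin x))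

theorem continuous_truncArcsin : Continuous truncArcsin := by
  unfold truncArcsin; fun_prop

theorem truncArcsin_neg (x : ℝ) : truncArcsin (-x) = -truncArcsin x := by
  unfold truncArcsin
  rw [Real.arcsin_neg, mul_neg]
  grind

/-- The bound π/4 is exactly what keeps 4x/π in [-1, 1], so neither truncation acts. -/
theorem truncArcsin_sin {x : ℝ} (hx : |x| ≤ Real.pi / 4) :
    truncArcsin (Real.sin x) = 4 / Real.pi * x := by
  have hp := Real.pi_pos
  obtain ⟨h1, h2⟩ := abs_le.1 hx
  have h3 : 4 / Real.pi * x ≤ 1 := by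
    rw [div_mul_eq_mul_div, div_le_one hp]; linarith
  have h4 : -1 ≤ 4 / Real.pi * x := by
    rw [div_mul_eq_mul_div, le_div_iff₀ hp]; linarith
  rw [truncArcsin, Real.arcsin_sin (by linarith) (by linarith), min_eq_right h3, max_eq_right h4]

/-- Here the arcsine is π/2 - |x| ≥ π/4, so the upper truncation takes over. -/
theorem truncArcsin_cos {x : ℝ} (hx : |x| ≤ Real.pi / 4) : truncArcsin (Real.cos x) = 1 := by
  have hp := Real.pi_pos
  have h : Real.arcsin (Real.cos x) = Real.pi / 2 - |x| := by
    rw [← Real.cos_abs, ← Real.sin_pi_div_two_sub,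
      Real.arcsin_sin (by linarith) (by linarith [abs_nonneg x])]
  have h3 : 1 ≤ 4 / Real.pi * (Real.pi / 2 - |x|) := by
    rw [div_mul_eq_mul_div, one_le_div hp]; linarith
  rw [truncArcsin, h, min_eq_left h3, max_eq_right (by norm_num)]

/-! ### Functional calculus and odd lifts of symbols -/

theorem starAlgHom_cfc {A B : Type*} [CStarAlgebra A] [CStarAlgebra B] (φ : A →⋆ₐ[ℂ] B)
    {f : ℝ → ℝ} (hf : Continuous f) {a : A} (ha : IsSelfAdjoint a) :
    φ (cfc f a) = cfc f (φ a) := by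
  have hc : Continuous φ := AddMonoidHomClass.continuous_of_bound φ 1 fun a => by
    rw [one_mul]; exact NonUnitalStarAlgHom.norm_apply_le φ a
  exact StarAlgHom.map_cfc φ f a hf.continuousOn hc ha (ha.map φ)

/-- Evaluation of continuous functions at a point, as a `*`-homomorphism. -/
def evalHom {X A : Type*} [TopologicalSpace X] [CompactSpace X] [CStarAlgebra A] (x : X) :
    C(X, A) →⋆ₐ[ℂ] A where
  toFun F := F x
  map_one' := rfl
  map_mul' _ _ := rfl
  map_zero' := rfl
  map_add' _ _ := rfl
  commutes' _ := rfl
  map_star' _ := rfl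

namespace ToeplitzAlgebra

/-- The coaction at a point `k` of `ℤ₂`: the endomorphism `s ↦ k s`. -/
def grading (k : ℤˣ) : ToeplitzAlgebra →⋆ₐ[ℂ] ToeplitzAlgebra :=
  (evalHom k).comp (ToeplitzAlgebra.lift (tensorEquiv (s ⊗ₜ[ℂ] u)) isometry_s_tmul_u)

theorem grading_s (k : ℤˣ) : grading k s = u k • s := by
  change ToeplitzAlgebra.lift (tensorEquiv (s ⊗ₜ[ℂ] u)) isometry_s_tmul_u s k = _
  rw [lift_s]
  exact tensorToFun_tmul s u k

theorem grading_one : grading 1 = StarAlgHom.id ℂ ToeplitzAlgebra :=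
  hom_ext (by rw [grading_s]; simp [u])

theorem grading_neg_one_s : grading (-1) s = -s := by
  rw [grading_s]; simp [u]

/-- In C(ℤ₂, T) the coaction of a is k ↦ `grading k a` and a ⊗ u is k ↦ u(k)a. They always agree at
k = 1, so only k = -1 carries a condition. -/
theorem coaction_eq_tmul_u {a : ToeplitzAlgebra} (h : grading (-1) a = -a) :
    coaction a = a ⊗ₜ[ℂ] u := by
  apply (tensorEquiv (A := ToeplitzAlgebra)).injective
  have h1 : tensorEquiv (coaction a) =
      ToeplitzAlgebra.lift (tensorEquiv (s ⊗ₜ[ℂ] u)) isometry_s_tmul_u a :=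
    StarAlgEquiv.apply_symm_apply _ _
  refine h1.trans ?_
  ext k
  change grading k a = tensorToFun (a ⊗ₜ[ℂ] u) k
  rw [tensorToFun_tmul]
  rcases Int.units_eq_one_or k with rfl | rfl
  · rw [grading_one]; simp [u]
  · rw [h]; simp [u]

theorem symbol_s (z : Circle) : symbol s z = z :=
  congrArg (fun F : C(Circle, ℂ) => F z) (lift_s uTilde star_uTilde_mul_uTilde)

/-- The symbol at z is a character, and characters commute with functional calculus, which on a real
scalar is plain evaluation. -/
theorem symbol_cfc_apply {f : ℝ → ℝ} (hf : Continuous f) {a : ToeplitzAlgebra}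
    (ha : IsSelfAdjoint a) {z : Circle} {x : ℝ} (hx : symbol a z = x) :
    symbol (cfc f a) z = f x := by
  have h := starAlgHom_cfc ((evalHom z).comp symbol) hf ha
  change symbol (cfc f a) z = cfc f (symbol a z) at h
  rw [h, hx]
  exact cfc_algebraMap (A := ℂ) x f

/-- With γ the sign automorphism, γ(f(a)) = f(γ(a)) = f(-a) = -f(a). -/
theorem grading_cfc_of_odd {f : ℝ → ℝ} (hf : Continuous f) (hodd : ∀ x, f (-x) = -f x)
    {a : ToeplitzAlgebra} (ha : IsSelfAdjoint a) (h : grading (-1) a = -a) :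
    grading (-1) (cfc f a) = -cfc f a := by
  rw [starAlgHom_cfc _ hf ha, h, ← cfc_comp_neg f a hf.continuousOn ha]
  simp only [hodd]
  exact cfc_neg f a

theorem exists_odd_lift {a : ToeplitzAlgebra} (ha : IsSelfAdjoint a) (h : grading (-1) a = -a)
    {r : Circle → ℝ} (hr : ∀ z, symbol a z = r z) :
    ∃ b : ToeplitzAlgebra, grading (-1) b = -b ∧
      ∀ z, symbol b z = truncArcsin (r z) :=
  ⟨cfc truncArcsin a, grading_cfc_of_odd continuous_truncArcsin truncArcsin_neg ha h,
    fun z => symbol_cfc_apply continuous_truncArcsin ha (hr z)⟩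

theorem exists_odd_lift_re : ∃ b : ToeplitzAlgebra, grading (-1) b = -b ∧
    ∀ z : Circle, symbol b z = truncArcsin (z : ℂ).re := by
  refine exists_odd_lift (a := (2⁻¹ : ℂ) • (s + star s)) ?_ ?_ fun z => ?_
  · rw [isSelfAdjoint_iff, star_smul, star_add, star_star, add_comm]; simp
  · rw [map_smul, map_add, map_star, grading_neg_one_s, star_neg, ← neg_add, smul_neg]
  · rw [map_smul, map_add, map_star]
    simp only [ContinuousMap.smul_apply, ContinuousMap.add_apply, ContinuousMap.star_apply,
      symbol_s]
    rw [Complex.re_eq_add_conj]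
    simp; ring

theorem exists_odd_lift_im : ∃ b : ToeplitzAlgebra, grading (-1) b = -b ∧
    ∀ z : Circle, symbol b z = truncArcsin (z : ℂ).im := by
  refine exists_odd_lift (a := (2 * Complex.I)⁻¹ • (s - star s)) ?_ ?_ fun z => ?_
  · rw [isSelfAdjoint_iff, star_smul, star_sub, star_star, ← neg_sub s, smul_neg, ← neg_smul]
    congr 1
    simp [Complex.inv_I]
  · rw [map_smul, map_sub, map_star, grading_neg_one_s, star_neg, ← smul_neg]; congr 1; abel
  · rw [map_smul, map_sub, map_star]
    simp only [ContinuousMap.smul_apply, ContinuousMap.sub_apply, ContinuousMap.star_apply,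
      symbol_s]
    rw [Complex.im_eq_sub_conj, smul_eq_mul, inv_mul_eq_div]
    rfl

/-! ### An odd element in the kernel of the symbol map -/

/-- The projection onto the cokernel of `s`. -/
def defect : ToeplitzAlgebra := 1 - s * star s

theorem defect_mul_s : defect * s = 0 := by
  rw [defect, sub_mul, mul_assoc, star_s_mul_s]; simp

theorem star_s_mul_defect : star s * defect = 0 := by
  rw [defect, mul_sub, ← mul_assoc, star_s_mul_s]; simp

theorem defect_mul_defect : defect * defect = defect := by
  nth_rw 1 [defect]
  rw [sub_mul, mul_assoc, star_s_mul_defect]; simp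

theorem symbol_defect : symbol defect = 0 := by
  ext z
  rw [defect, map_sub, map_mul, map_star, map_one]
  simp only [ContinuousMap.sub_apply, ContinuousMap.mul_apply, ContinuousMap.star_apply,
      symbol_s, ContinuousMap.one_apply, ContinuousMap.zero_apply]
  change 1 - (z : ℂ) * starRingEnd ℂ z = 0
  rw [Complex.mul_conj, Circle.normSq_coe]; simp

theorem grading_defect : grading (-1) defect = defect := by
  simp [defect, map_star, grading_neg_one_s]

/-- An odd finite-rank element of the Toeplitz algebra, exchanging the first two basis vectors
in the representation on `ℓ²(ℕ)`. -/
def swap : ToeplitzAlgebra := s * defect + defect * star s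

theorem symbol_swap : symbol swap = 0 := by simp [swap, symbol_defect]

theorem grading_swap : grading (-1) swap = -swap := by
  simp only [swap, map_add, map_mul, map_star, grading_defect, grading_neg_one_s, star_neg,
    neg_mul, mul_neg, neg_add]

/-- From ps = 0 and s*p = 0 follow pk = ps* and ps*k = p. In the shift representation, k² fixes the
first basis vector, which spans the range of p. -/
theorem defect_mul_swap_sq : defect * swap ^ 2 = defect := by
  have h : defect * swap = defect * star s := by
    rw [swap, mul_add, ← mul_assoc, ← mul_assoc, defect_mul_s, defect_mul_defect]; simp
  have h2 : defect * star s * swap = defect := by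
    rw [swap, mul_add, mul_assoc, ← mul_assoc (star s), star_s_mul_s, mul_assoc, ← mul_assoc
      (star s) defect, star_s_mul_defect, one_mul, defect_mul_defect]; simp
  rw [sq, ← mul_assoc, h, h2]

end ToeplitzAlgebra

/-! ### Nonvanishing of the defect and of a perturbed product -/

theorem exists_nonunitary_isometry :
    ∃ S : lp (fun _ : ℕ => ℂ) 2 →L[ℂ] lp (fun _ : ℕ => ℂ) 2, star S * S = 1 ∧ S * star S ≠ 1 := by
  let E := lp (fun _ : ℕ => ℂ) 2
  let e : ℕ → E := fun i => lp.single 2 i 1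
  have he : Orthonormal ℂ e := by
    rw [orthonormal_iff_ite]
    intro i j
    rw [lp.inner_single_left]
    simp [e, lp.single_apply, Pi.single_apply]
  -- The unilateral shift: the isometry of ℓ² taking the i-th basis vector to the (i+1)-st.
  let W := (he.comp _ Nat.succ_injective).orthogonalFamily.linearIsometry
  refine ⟨W.toContinuousLinearMap, W.adjoint_comp_self, fun h => ?_⟩
  -- If SS* = 1 then e₀ lies in the range of the shift; yet every term of the expansion of W y is
  -- orthogonal to e₀.
  obtain ⟨y, hy⟩ : ∃ y, W y = e 0 :=
    ⟨star W.toContinuousLinearMap (e 0), DFunLike.congr_fun h (e 0)⟩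
  have hs := ((he.comp _ Nat.succ_injective).orthogonalFamily.hasSum_linearIsometry y).mapL
    (innerSL ℂ (e 0))
  have h0 : innerSL ℂ (e 0) (W y) = 0 := by
    refine hs.unique ?_
    convert hasSum_zero with i
    simp [he.inner_eq_zero (Nat.succ_ne_zero i).symm]
  rw [hy, innerSL_apply_apply, orthonormal_iff_ite.1 he] at h0
  simp at h0

theorem ToeplitzAlgebra.defect_ne_zero : ToeplitzAlgebra.defect ≠ 0 := by
  obtain ⟨S, h1, h2⟩ := exists_nonunitary_isometry
  intro h
  have := congrArg (ToeplitzAlgebra.lift S h1) h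
  rw [defect, map_sub, map_mul, map_star, map_one, map_zero, lift_s, sub_eq_zero] at this
  exact h2 this.symm

/-- The left factor depends only on d and the right one only on c, so taking second differences in
each variable multiplies two second differences. Each equals -2k², free of a and b even without
commutativity, and the product is 4k⁴. -/
theorem exists_one_sub_sq_mul_ne_zero {A : Type*} [Ring A] [Algebra ℂ A] (a b k : A)
    (hk : k ^ 2 * k ^ 2 ≠ 0) :
    ∃ c d : ℂ, (1 - (b + d • k) ^ 2) * (1 - (a + c • k) ^ 2) ≠ 0 := by
  by_contra! h
  apply hk
  have key (x : A) : (1 - (x + (1 : ℂ) • k) ^ 2) + (1 - (x + (-1 : ℂ) • k) ^ 2) -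
      (2 : ℂ) • (1 - (x + (0 : ℂ) • k) ^ 2) = (-2 : ℂ) • k ^ 2 := by
    simp only [one_smul, neg_smul, zero_smul, two_smul, sq]
    noncomm_ring
  have h4 : ((-2 : ℂ) • k ^ 2) * ((-2 : ℂ) • k ^ 2) = 0 := by
    -- Expanding leaves only the nine products with parameters in {1, -1, 0}, all zero by
    -- assumption.
    have comb (F G : ℂ → A) (hFG : ∀ c d, F d * G c = 0) :
        (F 1 + F (-1) - (2 : ℂ) • F 0) * (G 1 + G (-1) - (2 : ℂ) • G 0) = 0 := by
      simp only [mul_sub, sub_mul, mul_add, add_mul, mul_smul_comm, smul_mul_assoc, hFG]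
      simp
    exact (congrArg₂ (· * ·) (key b).symm (key a).symm).trans
      (comb (fun d => 1 - (b + d • k) ^ 2) (fun c => 1 - (a + c • k) ^ 2) h)
  rw [smul_mul_smul_comm] at h4
  exact (smul_eq_zero.1 h4).resolve_left (by norm_num)

/-! ### Symbols on the four arcs -/

theorem sigma1_eq_tmul {a : ToeplitzAlgebra} {f : C(ℤˣ, ℂ)} {g : C(I, ℂ)}
    (h : ∀ k t, symbol a (delta1 (k, t)) = f k * g t) : sigma1 a = f ⊗ₜ[ℂ] g := by
  apply (Algebra.TensorProduct.comm ℂ C(ℤˣ, ℂ) C(I, ℂ)).injective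
  apply (tensorEquiv (A := C(I, ℂ))).injective
  ext k t
  refine (tensorEquiv_comm_delta1Pullback (symbol a) k t).trans ((h k t).trans ?_)
  exact (congrArg (fun F : C(I, ℂ) => F t) (tensorToFun_tmul g f k)).symm

theorem sigma2_eq_tmul {a : ToeplitzAlgebra} {f : C(ℤˣ, ℂ)} {g : C(I, ℂ)}
    (h : ∀ t k, symbol a (delta2 (t, k)) = f k * g t) : sigma2 a = g ⊗ₜ[ℂ] f := by
  apply (tensorEquiv (A := C(I, ℂ))).injective
  ext k t
  refine (tensorEquiv_delta2Pullback (symbol a) t k).trans ((h t k).trans ?_)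
  exact (congrArg (fun F : C(I, ℂ) => F t) (tensorToFun_tmul g f k)).symm

theorem re_circleExp (x : ℝ) : (Circle.exp x : ℂ).re = Real.cos x := by
  rw [Circle.coe_exp, Complex.exp_ofReal_mul_I_re]

theorem im_circleExp (x : ℝ) : (Circle.exp x : ℂ).im = Real.sin x := by
  rw [Circle.coe_exp, Complex.exp_ofReal_mul_I_im]

theorem abs_pi_div_four_mul_le (t : I) : |Real.pi / 4 * t| ≤ Real.pi / 4 := by
  rw [abs_mul, abs_of_pos (by positivity)]
  exact mul_le_of_le_one_right (by positivity) (abs_le.2 t.2)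

/-- This and the next three angles are arranged, up to 2π, so that standard shift identities reduce
their sine and cosine to those of πt/4. -/
theorem delta1_one (t : I) : delta1 (1, t) = Circle.exp (Real.pi / 4 * t + 2 * Real.pi) := by
  change Circle.exp _ = _
  congr 1; push_cast; ring

theorem delta1_neg_one (t : I) : delta1 (-1, t) = Circle.exp (Real.pi - Real.pi / 4 * t) := by
  change Circle.exp _ = _
  congr 1; push_cast; ring

theorem delta2_one (t : I) : delta2 (t, 1) = Circle.exp (Real.pi / 2 - Real.pi / 4 * t) := by
  change Circle.exp _ = _
  congr 1; push_cast; ring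

theorem delta2_neg_one (t : I) :
    delta2 (t, -1) = Circle.exp (Real.pi / 4 * t - Real.pi / 2 + 2 * Real.pi) := by
  change Circle.exp _ = _
  congr 1; push_cast; ring

theorem truncArcsin_sin_pi_div_four_mul (t : I) :
    truncArcsin (Real.sin (Real.pi / 4 * t)) = t := by
  rw [truncArcsin_sin (abs_pi_div_four_mul_le t)]
  field_simp

theorem truncArcsin_cos_pi_div_four_mul (t : I) :
    truncArcsin (Real.cos (Real.pi / 4 * t)) = 1 :=
  truncArcsin_cos (abs_pi_div_four_mul_le t)

theorem truncArcsin_re_delta1 (k : ℤˣ) (t : I) :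
    truncArcsin (delta1 (k, t) : ℂ).re = ((k : ℤ) : ℝ) := by
  rcases Int.units_eq_one_or k with rfl | rfl
  · rw [delta1_one, re_circleExp, Real.cos_add_two_pi, truncArcsin_cos_pi_div_four_mul]; simp
  · rw [delta1_neg_one, re_circleExp, Real.cos_pi_sub, truncArcsin_neg,
      truncArcsin_cos_pi_div_four_mul]; simp

theorem truncArcsin_im_delta1 (k : ℤˣ) (t : I) : truncArcsin (delta1 (k, t) : ℂ).im = t := by
  rcases Int.units_eq_one_or k with rfl | rfl
  · rw [delta1_one, im_circleExp, Real.sin_add_two_pi, truncArcsin_sin_pi_div_four_mul]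
  · rw [delta1_neg_one, im_circleExp, Real.sin_pi_sub, truncArcsin_sin_pi_div_four_mul]

theorem truncArcsin_re_delta2 (t : I) (k : ℤˣ) : truncArcsin (delta2 (t, k) : ℂ).re = t := by
  rcases Int.units_eq_one_or k with rfl | rfl
  · rw [delta2_one, re_circleExp, Real.cos_pi_div_two_sub, truncArcsin_sin_pi_div_four_mul]
  · rw [delta2_neg_one, re_circleExp, Real.cos_add_two_pi, Real.cos_sub_pi_div_two,
      truncArcsin_sin_pi_div_four_mul]

theorem truncArcsin_im_delta2 (t : I) (k : ℤˣ) :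
    truncArcsin (delta2 (t, k) : ℂ).im = ((k : ℤ) : ℝ) := by
  rcases Int.units_eq_one_or k with rfl | rfl
  · rw [delta2_one, im_circleExp, Real.sin_pi_div_two_sub, truncArcsin_cos_pi_div_four_mul]; simp
  · rw [delta2_neg_one, im_circleExp, Real.sin_add_two_pi, Real.sin_sub_pi_div_two,
      truncArcsin_neg, truncArcsin_cos_pi_div_four_mul]; simp

end Toeplitz

end

theorem mainTheorem6 :
    ∃ φ₁ φ₂ : ToeplitzAlgebra,
      coaction φ₁ = φ₁ ⊗ₜ[ℂ] u ∧
      coaction φ₂ = φ₂ ⊗ₜ[ℂ] u ∧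
      sigma1 φ₁ = u ⊗ₜ[ℂ] (1 : C(I, ℂ)) ∧
      sigma2 φ₁ = iotaI ⊗ₜ[ℂ] (1 : C(ℤˣ, ℂ)) ∧
      sigma2 φ₂ = (1 : C(I, ℂ)) ⊗ₜ[ℂ] u ∧
      sigma1 φ₂ = (1 : C(ℤˣ, ℂ)) ⊗ₜ[ℂ] iotaI ∧
      (1 - φ₂ ^ 2) * (1 - φ₁ ^ 2) ≠ 0 := by
  obtain ⟨a, ha, ha'⟩ := ToeplitzAlgebra.exists_odd_lift_re
  obtain ⟨b, hb, hb'⟩ := ToeplitzAlgebra.exists_odd_lift_im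
  -- Multiplying k⁴ = 0 on the left by p and using pk² = p twice would give p = 0.
  have hk : ToeplitzAlgebra.swap ^ 2 * ToeplitzAlgebra.swap ^ 2 ≠ 0 := fun h => by
    have := congrArg (ToeplitzAlgebra.defect * ·) h
    simp only [← mul_assoc, ToeplitzAlgebra.defect_mul_swap_sq, mul_zero] at this
    exact ToeplitzAlgebra.defect_ne_zero this
  obtain ⟨c, d, hcd⟩ := exists_one_sub_sq_mul_ne_zero a b _ hk
  have hodd {x : ToeplitzAlgebra} (hx : ToeplitzAlgebra.grading (-1) x = -x) (c : ℂ) :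
      coaction (x + c • ToeplitzAlgebra.swap) = (x + c • ToeplitzAlgebra.swap) ⊗ₜ[ℂ] u :=
    ToeplitzAlgebra.coaction_eq_tmul_u (by
      rw [map_add, map_smul, hx, ToeplitzAlgebra.grading_swap, smul_neg, neg_add])
  have hsymb (x : ToeplitzAlgebra) (c : ℂ) :
      symbol (x + c • ToeplitzAlgebra.swap) = symbol x := by
    rw [map_add, map_smul, ToeplitzAlgebra.symbol_swap, smul_zero, add_zero]
  refine ⟨a + c • ToeplitzAlgebra.swap, b + d • ToeplitzAlgebra.swap, hodd ha c, hodd hb d,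
    sigma1_eq_tmul fun k t => ?_, sigma2_eq_tmul fun t k => ?_, sigma2_eq_tmul fun t k => ?_,
    sigma1_eq_tmul fun k t => ?_, hcd⟩
  · rw [hsymb, ha', truncArcsin_re_delta1]; simp [u]
  · rw [hsymb, ha', truncArcsin_re_delta2]; simp [iotaI]
  · rw [hsymb, hb', truncArcsin_im_delta2]; simp [u]
  · rw [hsymb, hb', truncArcsin_im_delta1]; simp [iotaI]
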